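/- Call a nonzero complex polynomial $p(x)=a_0+a_1x+\dots+a_nx^n$ of degree $n$ symmetric if $p(x)=x^n\,\overline{p}(1/x)$, i.e. $a_k=\overline{a_{n-k}}$ for $0\le k\le n$. Two symmetric polynomials $g,h$ are said to have interlacing roots if all their roots are simple and lie on the circle $|x|=1$, and between any two consecutive roots of either polynomial on the circle there lies one, and only one, root of the other (a polynomial with a single root has that root followed by itself after a full turn of the circle). Theorem 7. Let $g$ and $h$ be symmetric polynomials, let $n$ be the degree of $g$, and let $n\ge 1$. Then the roots of $g$ and $h$ interlace if and only if the function $z=h(x)/g(x)$ maps the disk $|x|<1$ onto one of the two $n$-sheeted half-planes $U=\{\operatorname{Im} z>0\}$ or $U=\{\operatorname{Im} z<0\}$; that is, $g$ has no zeros in the disk, all values of $h/g$ on the disk lie in $U$, and every $z\in U$ is taken in the disk exactly $n$ times, counted with multiplicity. Moreover, for each of the two half-planes $U$, the function $h/g$ maps the disk $|x|<1$ onto the $n$-sheeted half-plane $U$ in this sense if and only if the polynomial $h-zg$ has no zeros in the disk $|x|<1$ whenever $\operatorname{Im} z\ne0$ and $z\notin U$, and has degree $n$ and all its zeros in the disk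 $|x|<1$ whenever $z\in U$. -/

import Mathlib

open Polynomial

/-- A symmetric polynomial: a nonzero complex polynomial `p` of degree `n` with
`p(x) = x ^ n * conj p (1 / x)`, where `conj p` has the conjugate coefficients; that is,
`a_k = conj a_{n-k}` for `0 ≤ k ≤ n`. Here `n` is the degree of `p` itself. -/
def IsSymmetricPoly (p : ℂ[X]) : Prop :=
  p ≠ 0 ∧ p.reverse.map (starRingEnd ℂ) = p

/-- All roots of `p` are simple and lie on the unit circle. -/
def SimpleRootsOnCircle (p : ℂ[X]) : Prop :=
  ∀ x : ℂ, p.IsRoot x → ‖x‖ = 1 ∧ p.rootMultiplicity x = 1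

/-- `φ < ψ` are arguments of two consecutive roots of `p` on the unit circle: there is no root of
`p` with argument strictly between them. If `p` has only one root `exp (i φ)` on the circle,
then this root is followed by itself, with `ψ = φ + 2 π`. -/
def ConsecutiveRootArgs (p : ℂ[X]) (φ ψ : ℝ) : Prop :=
  φ < ψ ∧ p.IsRoot (Complex.exp (φ * Complex.I)) ∧ p.IsRoot (Complex.exp (ψ * Complex.I)) ∧
    ∀ θ : ℝ, φ < θ → θ < ψ → ¬ p.IsRoot (Complex.exp (θ * Complex.I))

/-- Between any two consecutive roots of `p` on the unit circle there lies one, and only one, root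
of `q`. -/
def OneRootBetween (p q : ℂ[X]) : Prop :=
  ∀ φ ψ : ℝ, ConsecutiveRootArgs p φ ψ →
    ∃! θ : ℝ, φ < θ ∧ θ < ψ ∧ q.IsRoot (Complex.exp (θ * Complex.I))

/-- The roots of `g` and `h` interlace on the unit circle. -/
def InterlacingRoots (g h : ℂ[X]) : Prop :=
  SimpleRootsOnCircle g ∧ SimpleRootsOnCircle h ∧ OneRootBetween g h ∧ OneRootBetween h g

/-- `F` maps the domain `D` onto the `n`-sheeted domain over `U`: `F` is analytic on `D` with
values in `U`, and every value `w ∈ U` is taken in `D` exactly `n` times, counted with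
multiplicity. -/
def IsSheetedMap (n : ℕ) (D U : Set ℂ) (F : ℂ → ℂ) : Prop :=
  AnalyticOnNhd ℂ F D ∧ Set.MapsTo F D U ∧
    ∀ w ∈ U, {x | x ∈ D ∧ F x = w}.Finite ∧
      ∑ᶠ x ∈ {x | x ∈ D ∧ F x = w}, analyticOrderNatAt (fun y => F y - w) x = n

/-- The function `h / g` maps the open unit disk onto the `n`-sheeted domain over `U`; in
particular it has no poles in the disk. -/
def QuotientMapsDisk (n : ℕ) (g h : ℂ[X]) (U : Set ℂ) : Prop :=
  (∀ x ∈ Metric.ball (0 : ℂ) 1, g.eval x ≠ 0) ∧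
    IsSheetedMap n (Metric.ball (0 : ℂ) 1) U (fun x => h.eval x / g.eval x)

/-- `p` has no zeros in the open unit disk. -/
def NoZerosInDisk (p : ℂ[X]) : Prop :=
  ∀ x ∈ Metric.ball (0 : ℂ) 1, p.eval x ≠ 0

/-- `p` is of degree `n` and all its zeros lie in the open unit disk. -/
def AllZerosInDisk (n : ℕ) (p : ℂ[X]) : Prop :=
  p ≠ 0 ∧ p.natDegree = n ∧ ∀ x : ℂ, p.eval x = 0 → x ∈ Metric.ball (0 : ℂ) 1

open Filter Topology
open scoped ComplexConjugate

/-! The values of `h / g` are governed by the pencil `h - z g`: wherever `g` does not vanish, the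
points where `h / g = z` are the zeros of `h - z g`, with the same multiplicities. Replacing `h` by
`-h` exchanges the half-planes, so it is enough to treat the upper one.

Covering implies interlacing. The main point is that `h` also has degree `n`
(`CoversHalfPlane.natDegree_eq`): otherwise `h / g` would have to be real at almost every point of
the circle, which the symmetry of `g` and `h` forbids. Hence `P = h - i g` has degree `n` and all
its zeros in the disk. Multiplied by `exp (-i n θ / 2)`, the polynomials `h` and `g` become real
functions `H` and `G` on the circle, and the argument of `H - i G` strictly increases because each
zero of `P` contributes more than `1/2` to `Re (x P' / P)`. So the Wronskian `H' G - H G'` is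
positive (`wronskian_realLift_pos`), and Rolle's theorem gives simple, interlacing zeros.

Interlacing implies covering. The degrees agree by counting gaps. For real `t`, `h - t g` changes
sign between consecutive roots of `g`, so all its zeros are already on the circle and `h / g` is
never real in the disk (`InterlacingRoots.im_ne_zero`). By connectedness its imaginary part keeps
one sign there. Reflection in the circle turns the absence of zeros of `h - z g` in the disk for `z`
in one half-plane into the presence of all of them for the conjugate `z`. -/

/-! ### Sheeted maps as root counts -/

/-- The number of zeros of `p` in the open unit disk, counted with multiplicity. -/
noncomputable def diskRootCount (p : ℂ[X]) : ℕ :=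
  ∑ x ∈ p.roots.toFinset with ‖x‖ < 1, p.rootMultiplicity x

/-- Polynomial form of `QuotientMapsDisk`. -/
def CoversHalfPlane (g h : ℂ[X]) (U : Set ℂ) : Prop :=
  (∀ x : ℂ, ‖x‖ < 1 → g.eval x ≠ 0) ∧ (∀ x : ℂ, ‖x‖ < 1 → h.eval x / g.eval x ∈ U) ∧
    ∀ w ∈ U, h - C w * g ≠ 0 ∧ diskRootCount (h - C w * g) = g.natDegree

theorem analyticAt_eval_div (g h : ℂ[X]) {x : ℂ} (hx : g.eval x ≠ 0) :
    AnalyticAt ℂ (fun y => h.eval y / g.eval y) x := by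
  refine AnalyticAt.div ?_ ?_ hx
  · simpa using AnalyticOnNhd.eval_polynomial h x (Set.mem_univ x)
  · simpa using AnalyticOnNhd.eval_polynomial g x (Set.mem_univ x)

theorem eventually_eval_ne_zero {g : ℂ[X]} {x : ℂ} (hx : g.eval x ≠ 0) :
    ∀ᶠ y in 𝓝 x, g.eval y ≠ 0 :=
  g.continuous.continuousAt.eventually_ne hx

theorem eval_div_eq_iff {g h : ℂ[X]} {x w : ℂ} (hx : g.eval x ≠ 0) :
    h.eval x / g.eval x = w ↔ (h - C w * g).eval x = 0 := by
  rw [div_eq_iff hx]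
  simp [sub_eq_zero]

/-- Near `x` the function is `(h - w g) / g` with nonvanishing denominator, so its order is that of
the numerator. -/
theorem analyticOrderNatAt_eval_div_sub {g h : ℂ[X]} {x w : ℂ} (hx : g.eval x ≠ 0)
    (hp : h - C w * g ≠ 0) :
    analyticOrderNatAt (fun y => h.eval y / g.eval y - w) x
      = (h - C w * g).rootMultiplicity x := by
  have han : AnalyticAt ℂ (fun y => h.eval y / g.eval y - w) x :=
    (analyticAt_eval_div g h hx).sub analyticAt_const
  have key : analyticOrderAt (fun y => h.eval y / g.eval y - w) x
      = ((h - C w * g).rootMultiplicity x : ℕ) := by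
    rw [han.analyticOrderAt_eq_natCast]
    obtain ⟨q, hq, hdvd⟩ := exists_eq_pow_rootMultiplicity_mul_and_not_dvd _ hp x
    refine ⟨fun y => q.eval y / g.eval y, analyticAt_eval_div g q hx, ?_, ?_⟩
    · rw [dvd_iff_isRoot] at hdvd
      exact div_ne_zero hdvd hx
    · filter_upwards [eventually_eval_ne_zero hx] with y hy
      have h1 := congrArg (eval y) hq
      simp only [eval_sub, eval_mul, eval_C, eval_pow, eval_X] at h1
      rw [smul_eq_mul, ← mul_div_assoc, ← h1]
      field_simp
  simp [analyticOrderNatAt, key]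

theorem infinite_of_eventually_isRoot {p : ℂ[X]} {x : ℂ} (h : ∀ᶠ y in 𝓝 x, p.eval y = 0) :
    p = 0 := by
  refine eq_zero_of_infinite_isRoot p ?_
  exact infinite_of_mem_nhds x h

theorem quotientMapsDisk_iff {g h : ℂ[X]} {U : Set ℂ} :
    QuotientMapsDisk g.natDegree g h U ↔ CoversHalfPlane g h U := by
  unfold QuotientMapsDisk CoversHalfPlane IsSheetedMap
  simp only [mem_ball_zero_iff]
  refine and_congr_right fun hg => ?_
  have han : AnalyticOnNhd ℂ (fun x => h.eval x / g.eval x) (Metric.ball 0 1) := fun x hx =>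
    analyticAt_eval_div g h (hg x (by simpa using hx))
  have hmaps : Set.MapsTo (fun x => h.eval x / g.eval x) (Metric.ball 0 1) U ↔
      ∀ x : ℂ, ‖x‖ < 1 → h.eval x / g.eval x ∈ U := by simp [Set.MapsTo]
  simp only [han, true_and, hmaps]
  refine and_congr_right fun _ => forall₂_congr fun w _ => ?_
  -- If `h = w g`, the fibre over `w` is the whole disk, which finiteness excludes on one side and
  -- `h - C w * g ≠ 0` on the other.
  by_cases hp : h - C w * g = 0
  · have hset : {x : ℂ | ‖x‖ < 1 ∧ h.eval x / g.eval x = w} = Metric.ball 0 1 := by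
      ext x
      simp only [Set.mem_ofPred_eq, mem_ball_zero_iff, and_iff_left_iff_imp]
      intro hx
      rw [eval_div_eq_iff (hg x hx), hp, eval_zero]
    have hinf : ¬ (Metric.ball (0 : ℂ) 1).Finite :=
      infinite_of_mem_nhds (0 : ℂ) (Metric.ball_mem_nhds 0 one_pos)
    rw [hset]
    simp [hp, hinf]
  · have hset : {x : ℂ | ‖x‖ < 1 ∧ h.eval x / g.eval x = w}
        = ((h - C w * g).roots.toFinset.filter (fun x => ‖x‖ < 1) : Finset ℂ) := by
      ext x
      simp only [Set.mem_ofPred_eq, Finset.coe_filter, Multiset.mem_toFinset, mem_roots hp,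
        IsRoot.def]
      rw [and_comm]
      exact and_congr_left fun hx => eval_div_eq_iff (hg x hx)
    rw [hset, finsum_mem_coe_finset]
    have hsum : ∑ x ∈ (h - C w * g).roots.toFinset with ‖x‖ < 1,
        analyticOrderNatAt (fun y => h.eval y / g.eval y - w) x
          = diskRootCount (h - C w * g) := by
      refine Finset.sum_congr rfl fun x hx => ?_
      exact analyticOrderNatAt_eval_div_sub (hg x (Finset.mem_filter.mp hx).2) hp
    rw [hsum]
    exact ⟨fun H => ⟨hp, H.2⟩, fun H => ⟨Finset.finite_toSet _, H.2⟩⟩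

theorem coversHalfPlane_neg {g h : ℂ[X]} :
    CoversHalfPlane g (-h) {z | 0 < z.im} ↔ CoversHalfPlane g h {z | z.im < 0} := by
  have key : ∀ w : ℂ, -h - C (-w) * g = -(h - C w * g) := fun w => by simp; ring
  have hc : ∀ p : ℂ[X], diskRootCount (-p) = diskRootCount p := fun p => by
    simp [diskRootCount, ← count_roots]
  unfold CoversHalfPlane
  refine and_congr_right fun hg => and_congr ?_ ?_
  · simp [neg_div]
  · constructor
    · intro H w hw
      have := H (-w) (by simpa using hw)
      rwa [key, neg_ne_zero, hc] at this
    · intro H w hw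
      have := H (-w) (by simpa using hw)
      rwa [← neg_ne_zero, ← hc, ← key, neg_neg] at this

theorem diskRootCount_le (p : ℂ[X]) : diskRootCount p ≤ p.natDegree := by
  calc diskRootCount p ≤ ∑ x ∈ p.roots.toFinset, p.rootMultiplicity x :=
        Finset.sum_le_sum_of_subset (Finset.filter_subset _ _)
    _ = p.roots.card := by simp_rw [← count_roots]; exact Multiset.toFinset_sum_count_eq _
    _ ≤ p.natDegree := p.card_roots'

theorem diskRootCount_eq_natDegree_iff {p : ℂ[X]} (hp : p ≠ 0) :
    diskRootCount p = p.natDegree ↔ ∀ x : ℂ, p.eval x = 0 → ‖x‖ < 1 := by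
  have hcard : p.natDegree = ∑ x ∈ p.roots.toFinset, p.rootMultiplicity x := by
    simp_rw [← count_roots]
    rw [Multiset.toFinset_sum_count_eq]
    exact (IsAlgClosed.splits p).natDegree_eq_card_roots
  rw [hcard, diskRootCount]
  constructor
  · intro H x hx
    by_contra hlt
    have hxr : x ∈ p.roots.toFinset := by simp [hp, hx]
    refine absurd H (ne_of_lt ?_)
    refine Finset.sum_lt_sum_of_subset (Finset.filter_subset _ _) hxr (by simp [hlt]) ?_
      (fun _ _ _ => Nat.zero_le _)
    exact (rootMultiplicity_pos hp).mpr hx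
  · intro H
    rw [Finset.filter_true_of_mem]
    intro x hx
    exact H x (by simpa [hp] using hx)

/-- Polynomial form of the root condition for the upper half-plane. -/
def SplitsHalfPlanes (g h : ℂ[X]) : Prop :=
  (∀ z : ℂ, z.im < 0 → NoZerosInDisk (h - C z * g)) ∧
    ∀ z : ℂ, 0 < z.im → AllZerosInDisk g.natDegree (h - C z * g)

/-! ### Reflection in the unit circle -/

theorem IsSymmetricPoly.eval_eq {p : ℂ[X]} (hp : IsSymmetricPoly p) {x : ℂ} (hx : x ≠ 0) :
    p.eval x = x ^ p.natDegree * conj (p.eval (conj x)⁻¹) := by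
  have hcx : conj x ≠ 0 := by simpa using hx
  have h1 : p.eval x = conj (p.reverse.eval (conj x)) := by
    conv_lhs => rw [← hp.2]
    rw [← Complex.conj_conj x, eval_map_apply, Complex.conj_conj]
  have hinv : Invertible (conj x)⁻¹ := invertibleOfNonzero (inv_ne_zero hcx)
  have h2 := eval₂_reverse_mul_pow (RingHom.id ℂ) (conj x)⁻¹ p
  rw [invOf_eq_inv, inv_inv] at h2
  change p.reverse.eval (conj x) * _ = p.eval _ at h2
  rw [h1, ← h2, map_mul, map_pow, map_inv₀, Complex.conj_conj,
    inv_pow]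
  field_simp

theorem IsSymmetricPoly.eval_eq_of_norm_eq_one {p : ℂ[X]} (hp : IsSymmetricPoly p) {x : ℂ}
    (hx : ‖x‖ = 1) : p.eval x = x ^ p.natDegree * conj (p.eval x) := by
  have hx0 : x ≠ 0 := by rintro rfl; simp at hx
  have h1 : (conj x)⁻¹ = x := by
    rw [inv_eq_iff_eq_inv, Complex.inv_def, Complex.normSq_eq_norm_sq, hx]; simp
  conv_lhs => rw [hp.eval_eq hx0, h1]

/-- A symmetric polynomial without zeros inside the disk has all its zeros on the circle. -/
theorem IsSymmetricPoly.norm_eq_one_of_isRoot {p : ℂ[X]} (hp : IsSymmetricPoly p)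
    (hD : ∀ x : ℂ, ‖x‖ < 1 → p.eval x ≠ 0) {x : ℂ} (hx : p.eval x = 0) : ‖x‖ = 1 := by
  rcases lt_trichotomy ‖x‖ 1 with h | h | h
  · exact absurd hx (hD x h)
  · exact h
  · have hx0 : x ≠ 0 := by rintro rfl; simp at h; linarith
    rw [hp.eval_eq hx0] at hx
    have h2 : p.eval (conj x)⁻¹ = 0 := by simpa [hx0] using hx
    refine absurd h2 (hD _ ?_)
    rw [norm_inv, RCLike.norm_conj]
    exact inv_lt_one_of_one_lt₀ h

theorem infinite_unit_circle : {x : ℂ | ‖x‖ = 1}.Infinite := by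
  -- The angle `2 arctan t` stays in `(-π, π)`, so `arg` recovers it.
  have h : Function.Injective (fun t : ℝ => Complex.exp (((2 * Real.arctan t : ℝ) : ℂ) * Complex.I)) := by
    intro s t hst
    have := congrArg Complex.arg hst
    simp only at this
    rw [Complex.arg_exp_mul_I, Complex.arg_exp_mul_I] at this
    have e : ∀ u : ℝ, toIocMod Real.two_pi_pos (-Real.pi) (2 * Real.arctan u) = 2 * Real.arctan u := by
      intro u
      rw [toIocMod_eq_self]
      have := Real.neg_pi_div_two_lt_arctan u
      have := Real.arctan_lt_pi_div_two u
      constructor <;> linarith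
    rw [e, e] at this
    exact Real.arctan_injective (by linarith)
  refine (Set.infinite_range_of_injective h).mono ?_
  rintro _ ⟨t, rfl⟩
  exact Complex.norm_exp_ofReal_mul_I _

/-- A polynomial that vanishes on the circle outside a finite set is zero. -/
theorem eq_zero_of_circle {p : ℂ[X]} {S : Set ℂ} (hS : S.Finite)
    (h : ∀ x : ℂ, ‖x‖ = 1 → x ∉ S → p.eval x = 0) : p = 0 :=
  eq_zero_of_infinite_isRoot p
    ((infinite_unit_circle.sdiff hS).mono fun x hx => h x hx.1 hx.2)

theorem norm_lt_one_nhds {x : ℂ} (hx : ‖x‖ < 1) : ∀ᶠ y in 𝓝 x, ‖y‖ < 1 :=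
  continuous_norm.continuousAt.eventually_lt continuousAt_const hx

theorem frequently_norm_lt_one {x : ℂ} (hx : ‖x‖ = 1) : ∃ᶠ y in 𝓝 x, ‖y‖ < 1 := by
  have : x ∈ closure (Metric.ball (0 : ℂ) 1) := by
    rw [closure_ball _ one_ne_zero]; simp [hx]
  simpa using mem_closure_iff_frequently.mp this

/-! ### Covering a half-plane and the zeros of `h - z g` -/

/-- Either `h / g` is constant or it is open at `x`. -/
theorem nhds_le_map_eval_div {g h : ℂ[X]} {x : ℂ} (hx : g.eval x ≠ 0)
    (hne : h - C (h.eval x / g.eval x) * g ≠ 0) :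
    𝓝 (h.eval x / g.eval x) ≤ map (fun y => h.eval y / g.eval y) (𝓝 x) := by
  refine (analyticAt_eval_div g h hx).eventually_constant_or_nhds_le_map_nhds.resolve_left ?_
  intro H
  refine hne (infinite_of_eventually_isRoot (x := x) ?_)
  filter_upwards [H, eventually_eval_ne_zero hx] with y h1 h2
  exact (eval_div_eq_iff h2).mp h1

theorem coversHalfPlane_of_splitsHalfPlanes {g h : ℂ[X]} (hg0 : g ≠ 0) (hn : 0 < g.natDegree)
    (H : SplitsHalfPlanes g h) : CoversHalfPlane g h {z | 0 < z.im} := by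
  obtain ⟨hL, hU⟩ := H
  have hne : ∀ c : ℂ, h - C c * g ≠ 0 := by
    intro c hc
    have hh : h = C c * g := sub_eq_zero.mp hc
    -- If `h = c g`, a root of `g` is a zero of both `h - i g` and `h + i g`: the first puts it in
    -- the disk, the second keeps it out.
    obtain ⟨x, hx⟩ := IsAlgClosed.exists_root g (by
      rw [degree_eq_natDegree hg0]; exact_mod_cast hn.ne')
    have hx' : g.eval x = 0 := hx
    have h1 := (hU Complex.I (by simp)).2.2 x (by simp [hh, hx'])
    exact hL (-Complex.I) (by simp) x h1 (by simp [hh, hx'])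
  have hg : ∀ x : ℂ, ‖x‖ < 1 → g.eval x ≠ 0 := by
    intro x hx hgx
    have hh : h.eval x ≠ 0 := by
      intro hhx
      exact hL (-Complex.I) (by simp) x (by simpa using hx) (by simp [hgx, hhx])
    -- At a pole of `h / g` the reciprocal `g / h` is open, so it takes a value `i t` with `t > 0`
    -- in the disk. There `h / g = -i / t`, a forbidden value in the lower half-plane.
    have hopen := nhds_le_map_eval_div (g := h) (h := g) hh (by simpa [hgx] using hg0)
    have hev : ∀ᶠ y in 𝓝 x, ‖y‖ < 1 ∧ h.eval y ≠ 0 :=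
      (norm_lt_one_nhds hx).and (eventually_eval_ne_zero hh)
    have hmem := hopen (image_mem_map hev)
    rw [hgx, zero_div] at hmem
    have ht : Tendsto (fun t : ℝ => (t : ℂ) * Complex.I) (𝓝[>] 0) (𝓝 0) := by
      have : Continuous (fun t : ℝ => (t : ℂ) * Complex.I) := by fun_prop
      have h2 := this.tendsto 0
      simp only [Complex.ofReal_zero, zero_mul] at h2
      exact h2.mono_left nhdsWithin_le_nhds
    obtain ⟨t, ⟨y, ⟨hy1, hy2⟩, hy3⟩, ht0⟩ :=
      ((ht.eventually hmem).and self_mem_nhdsWithin).exists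
    beta_reduce at hy3
    rw [div_eq_iff hy2] at hy3
    have htc : (t : ℂ) ≠ 0 := by exact_mod_cast ht0.ne'
    refine hL (-Complex.I * (t : ℂ)⁻¹) ?_ y (by simpa using hy1) ?_
    · rw [← Complex.ofReal_inv]
      simp [ht0]
    · simp only [eval_sub, eval_mul, eval_C, hy3]
      field_simp
      simp
  have hge : ∀ x : ℂ, ‖x‖ < 1 → 0 ≤ (h.eval x / g.eval x).im := by
    intro x hx
    by_contra! hlt
    exact hL _ hlt x (by simpa using hx) ((eval_div_eq_iff (hg x hx)).mp rfl)
  refine ⟨hg, fun x hx => ?_, fun w hw => ⟨hne w, ?_⟩⟩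
  · have hopen := nhds_le_map_eval_div (hg x hx) (hne _)
    have hmem := hopen (image_mem_map (norm_lt_one_nhds hx))
    have ht : Tendsto (fun t : ℝ => h.eval x / g.eval x - (t : ℂ) * Complex.I) (𝓝[>] 0)
        (𝓝 (h.eval x / g.eval x)) := by
      have : Continuous (fun t : ℝ => h.eval x / g.eval x - (t : ℂ) * Complex.I) := by fun_prop
      have h2 := this.tendsto 0
      simp only [Complex.ofReal_zero, zero_mul, sub_zero] at h2
      exact h2.mono_left nhdsWithin_le_nhds
    obtain ⟨t, ⟨y, hy1, hy3⟩, ht0⟩ := ((ht.eventually hmem).and self_mem_nhdsWithin).exists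
    have h1 := hge y hy1
    beta_reduce at hy3
    rw [hy3] at h1
    simp at h1 ht0 ⊢
    linarith
  · obtain ⟨_, hdeg, hz⟩ := hU w hw
    rw [← hdeg, diskRootCount_eq_natDegree_iff (hne w)]
    intro x hx
    simpa using hz x hx

theorem splitsHalfPlanes_of_coversHalfPlane {g h : ℂ[X]} (hdeg : h.natDegree ≤ g.natDegree)
    (H : CoversHalfPlane g h {z | 0 < z.im}) : SplitsHalfPlanes g h := by
  obtain ⟨hg, hval, hcount⟩ := H
  refine ⟨fun z hz x hx h0 => ?_, fun z hz => ?_⟩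
  · have hx' : ‖x‖ < 1 := by simpa using hx
    have h1 := hval x hx'
    rw [(eval_div_eq_iff (hg x hx')).mpr h0] at h1
    exact lt_asymm hz h1
  · obtain ⟨hne, hc⟩ := hcount z hz
    have h1 : (h - C z * g).natDegree ≤ g.natDegree := by
      refine (natDegree_sub_le _ _).trans (max_le hdeg ?_)
      exact natDegree_C_mul_le _ _
    -- The `n` zeros in the disk leave no room for a drop in degree or for zeros elsewhere.
    have h2 : (h - C z * g).natDegree = g.natDegree :=
      le_antisymm h1 (hc ▸ diskRootCount_le _)
    refine ⟨hne, h2, fun x hx => ?_⟩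
    rw [← h2, diskRootCount_eq_natDegree_iff hne] at hc
    simpa using hc x hx

/-! ### A covering forces equal degrees -/

theorem sub_C_mul_ne_zero {g h : ℂ[X]} (hh : h ≠ 0) (hmn : h.natDegree ≠ g.natDegree) (c : ℂ) :
    h - C c * g ≠ 0 := by
  intro hc
  have hc' : h = C c * g := sub_eq_zero.mp hc
  have hc0 : c ≠ 0 := by rintro rfl; simp at hc'; exact hh hc'
  exact hmn (by rw [hc', natDegree_C_mul hc0])

/-- With `m = deg h` and `n = deg g`, the coefficient of `X ^ (m + n)` is `(m - n)` times the
product of the leading coefficients. The factor `X` makes differentiation preserve degrees and so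
avoids the exponent `m + n - 1`. -/
theorem derivative_mul_sub_ne_zero {g h : ℂ[X]} (hg : g ≠ 0) (hh : h ≠ 0)
    (hmn : h.natDegree ≠ g.natDegree) : X * (derivative h * g - h * derivative g) ≠ 0 := by
  intro H
  have h1 := congrArg (fun p => coeff p (h.natDegree + g.natDegree)) H
  have e : X * (derivative h * g - h * derivative g)
      = (X * derivative h) * g - h * (X * derivative g) := by ring
  have hd : ∀ p : ℂ[X], (X * derivative p).natDegree ≤ p.natDegree ∧
      (X * derivative p).coeff p.natDegree = p.natDegree * p.leadingCoeff := by
    intro p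
    have hc : ∀ k, (X * derivative p).coeff k = k * p.coeff k := by
      intro k
      cases k with
      | zero => simp
      | succ k => rw [coeff_X_mul, coeff_derivative]; push_cast; ring
    refine ⟨?_, hc _⟩
    rw [natDegree_le_iff_coeff_eq_zero]
    intro k hk
    rw [hc, coeff_eq_zero_of_natDegree_lt hk, mul_zero]
  simp only [e, coeff_sub, coeff_zero] at h1
  rw [coeff_mul_add_eq_of_natDegree_le (hd h).1 le_rfl,
    coeff_mul_add_eq_of_natDegree_le le_rfl (hd g).1, (hd h).2, (hd g).2, coeff_natDegree,
    coeff_natDegree] at h1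
  have h2 : ((h.natDegree : ℂ) - g.natDegree) * (h.leadingCoeff * g.leadingCoeff) = 0 := by
    linear_combination h1
  rcases mul_eq_zero.mp h2 with h3 | h3
  · exact hmn (by exact_mod_cast sub_eq_zero.mp h3)
  · simp [hg, hh] at h3

/-- At a boundary point whose value lies in the half-plane, the quotient takes a critical value. -/
theorem exists_critical_value_eq {g h : ℂ[X]} {U : Set ℂ}
    (hne : ∀ c : ℂ, h - C c * g ≠ 0) (H : CoversHalfPlane g h U) {x : ℂ} (hx : ‖x‖ = 1)
    (hgx : g.eval x ≠ 0) (hxU : h.eval x / g.eval x ∈ U) :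
    ∃ c : ℂ, (derivative h * g - h * derivative g).eval c = 0 ∧
      (h - C (h.eval c / g.eval c) * g).eval x = 0 := by
  obtain ⟨hg, hval, hcount⟩ := H
  -- If `w` is not a critical value, it has `n` distinct simple preimages in the disk. With the
  -- boundary preimage `x` there are `n + 1` points, and a value taken in the disk near `x` is taken
  -- near each of the others too: one time too many.
  by_contra! hcrit
  set w := h.eval x / g.eval x with hw
  set F : ℂ → ℂ := fun y => h.eval y / g.eval y with hF
  have hpx : (h - C w * g).eval x = 0 := (eval_div_eq_iff hgx).mp rfl
  set T := (h - C w * g).roots.toFinset.filter (fun y => ‖y‖ < 1) with hT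
  have hTmem : ∀ y ∈ T, ‖y‖ < 1 ∧ (h - C w * g).eval y = 0 := by
    intro y hy
    rw [hT, Finset.mem_filter, Multiset.mem_toFinset, mem_roots (hne w)] at hy
    exact ⟨hy.2, hy.1⟩
  have hTF : ∀ y ∈ T, F y = w := fun y hy =>
    (eval_div_eq_iff (hg y (hTmem y hy).1)).mpr (hTmem y hy).2
  have hsimple : ∀ y ∈ T, (h - C w * g).rootMultiplicity y = 1 := by
    intro y hy
    obtain ⟨hy1, hy2⟩ := hTmem y hy
    have hpos := (rootMultiplicity_pos (hne w)).mpr hy2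
    by_contra hn1
    have hd := ((one_lt_rootMultiplicity_iff_isRoot (t := y) (hne w)).mp (by omega)).2
    refine hcrit y ?_ ?_
    · simp only [IsRoot.def, derivative_sub, derivative_C_mul, eval_sub, eval_mul, eval_C]
        at hd hy2 ⊢
      linear_combination (g.eval y) * hd - (derivative g).eval y * hy2
    · change (h - C (F y) * g).eval x = 0
      rw [hTF y hy]
      exact hpx
  have hTcard : T.card = g.natDegree := by
    rw [← (hcount w hxU).2, diskRootCount, Finset.sum_congr rfl hsimple]
    simp
  have hxT : x ∉ T := fun hxT => absurd (hTmem x hxT).1 (by rw [hx]; exact lt_irrefl 1)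
  obtain ⟨V, hV, hdisj⟩ := (Finset.finite_toSet (insert x T)).t2_separation
  have hcont : ContinuousAt F x := (analyticAt_eval_div g h hgx).continuousAt
  have hev : ∀ᶠ y in 𝓝 x, y ∈ V x ∧ ∀ t ∈ T, F y ∈ F '' {s | s ∈ V t ∧ ‖s‖ < 1} := by
    refine Filter.Eventually.and ((hV x).2.mem_nhds (hV x).1) ?_
    rw [Filter.eventually_all_finset]
    intro t ht
    refine hcont ?_
    have h1 := nhds_le_map_eval_div (h := h) (hg t (hTmem t ht).1) (hne _)
    have h2 := h1 (image_mem_map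
      (inter_mem ((hV t).2.mem_nhds (hV t).1) (norm_lt_one_nhds (hTmem t ht).1)))
    rw [show h.eval t / g.eval t = F x from hTF t ht] at h2
    exact h2
  obtain ⟨y, hy1, hyV, hyT⟩ := ((frequently_norm_lt_one hx).and_eventually hev).exists
  have hch : ∀ t ∈ insert x T, ∃ s, s ∈ V t ∧ ‖s‖ < 1 ∧ F s = F y := by
    intro t ht
    rcases Finset.mem_insert.mp ht with rfl | ht
    · exact ⟨y, hyV, hy1, rfl⟩
    · obtain ⟨s, ⟨h1, h2⟩, h3⟩ := hyT t ht
      exact ⟨s, h1, h2, h3⟩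
  choose! s hsV hs1 hsF using hch
  obtain ⟨hne', hcnt⟩ := hcount (F y) (hval y hy1)
  set T' := (h - C (F y) * g).roots.toFinset.filter (fun y => ‖y‖ < 1) with hT'
  have hle : (insert x T).card ≤ T'.card := by
    refine Finset.card_le_card_of_injOn s ?_ ?_
    · intro t ht
      rw [Finset.mem_coe, hT', Finset.mem_filter, Multiset.mem_toFinset, mem_roots hne']
      exact ⟨(eval_div_eq_iff (hg _ (hs1 t ht))).mp (hsF t ht), hs1 t ht⟩
    · intro a ha b hb hab
      by_contra hne2
      have := hdisj ha hb hne2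
      exact Set.disjoint_left.mp this (hsV a ha) (hab ▸ hsV b hb)
  have hle' : T'.card ≤ g.natDegree := by
    rw [← hcnt, Finset.card_eq_sum_ones]
    refine Finset.sum_le_sum fun z hz => ?_
    refine (rootMultiplicity_pos hne').mpr ?_
    rw [hT', Finset.mem_filter, Multiset.mem_toFinset, mem_roots hne'] at hz
    exact hz.1
  rw [Finset.card_insert_of_notMem hxT, hTcard] at hle
  omega

/-- Boundary values lie in the closed half-plane, and by `exists_critical_value_eq` they can be
nonreal only at finitely many points. Where `h / g` is real, symmetry gives `x ^ deg h = x ^ deg g`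
unless `h x = 0`; for distinct degrees this cannot hold at almost every point of the circle. -/
theorem CoversHalfPlane.natDegree_eq {g h : ℂ[X]} (hg : IsSymmetricPoly g)
    (hh : IsSymmetricPoly h) (H : CoversHalfPlane g h {z | 0 < z.im}) :
    h.natDegree = g.natDegree := by
  by_contra hmn
  have hne := sub_C_mul_ne_zero hh.1 hmn
  have hWr := derivative_mul_sub_ne_zero hg.1 hh.1 hmn
  have hfin : ∀ p : ℂ[X], p ≠ 0 → {x : ℂ | p.eval x = 0}.Finite := fun p hp =>
    p.finite_setOfPred_isRoot hp
  set S : Set ℂ := {x | g.eval x = 0} ∪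
    ⋃ c ∈ {c : ℂ | (derivative h * g - h * derivative g).eval c = 0},
      {x | (h - C (h.eval c / g.eval c) * g).eval x = 0} with hS
  have hSfin : S.Finite := by
    refine (hfin g hg.1).union ((hfin _ (right_ne_zero_of_mul hWr)).biUnion fun c _ => ?_)
    exact hfin _ (hne _)
  have hzero : (X ^ h.natDegree - X ^ g.natDegree) * h = (0 : ℂ[X]) := by
    refine eq_zero_of_circle hSfin fun x hx hxS => ?_
    have hgx : g.eval x ≠ 0 := fun h0 => hxS (Or.inl h0)
    have hnpos : ¬ 0 < (h.eval x / g.eval x).im := by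
      intro hpos
      obtain ⟨c, hc1, hc2⟩ := exists_critical_value_eq hne H hx hgx hpos
      exact hxS (Or.inr (Set.mem_biUnion hc1 hc2))
    have hnneg : 0 ≤ (h.eval x / g.eval x).im := by
      have hcont : ContinuousAt (fun y => (h.eval y / g.eval y).im) x :=
        Complex.continuous_im.continuousAt.comp (analyticAt_eval_div g h hgx).continuousAt
      by_contra! hlt
      obtain ⟨y, hy1, hy2⟩ := ((frequently_norm_lt_one hx).and_eventually
        (hcont.eventually_lt continuousAt_const hlt)).exists
      exact lt_asymm hy2 (H.2.1 y hy1)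
    have him : (h.eval x / g.eval x).im = 0 := le_antisymm (not_lt.mp hnpos) hnneg
    have hreal : conj (h.eval x / g.eval x) = h.eval x / g.eval x := Complex.conj_eq_iff_im.mpr him
    have hgc : conj (g.eval x) ≠ 0 := by simpa using hgx
    rw [map_div₀, div_eq_div_iff hgc hgx] at hreal
    have h1 := hh.eval_eq_of_norm_eq_one hx
    have h2 := hg.eval_eq_of_norm_eq_one hx
    simp only [eval_mul, eval_sub, eval_pow, eval_X]
    refine (mul_eq_zero.mp (?_ : conj (g.eval x) * _ = 0)).resolve_left hgc
    linear_combination (x ^ h.natDegree) * (-hreal) - (g.eval x) * h1 + (h.eval x) * h2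
  rcases mul_eq_zero.mp hzero with h1 | h1
  · have := congrArg natDegree (sub_eq_zero.mp h1)
    simp at this
    exact hmn this
  · exact hh.1 h1

/-! ### Real lifts to the line and their Wronskian -/

/-- The function `exp (-i n θ / 2) * p (exp (i θ))`, which is real-valued for symmetric `p` of
degree `n`. -/
noncomputable def circleLift (n : ℕ) (p : ℂ[X]) (θ : ℝ) : ℂ :=
  Complex.exp (-(n / 2 * θ * Complex.I)) * p.eval (Complex.exp (θ * Complex.I))

/-- The derivative of `circleLift n p`. -/
noncomputable def circleLiftDeriv (n : ℕ) (p : ℂ[X]) (θ : ℝ) : ℂ :=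
  Complex.I * (Complex.exp (θ * Complex.I) * (derivative p).eval (Complex.exp (θ * Complex.I))
    - n / 2 * p.eval (Complex.exp (θ * Complex.I))) * Complex.exp (-(n / 2 * θ * Complex.I))

theorem hasDerivAt_circleLift (n : ℕ) (p : ℂ[X]) (θ : ℝ) :
    HasDerivAt (circleLift n p) (circleLiftDeriv n p θ) θ := by
  have h1 : HasDerivAt (fun z : ℂ => Complex.exp (-(n / 2 * z * Complex.I)))
      (Complex.exp (-(n / 2 * (θ : ℂ) * Complex.I)) * (-(n / 2 * 1 * Complex.I))) θ :=
    ((((hasDerivAt_id (θ : ℂ)).const_mul (n / 2 : ℂ)).mul_const Complex.I).fun_neg).cexp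
  have h2 : HasDerivAt (fun z : ℂ => Complex.exp (z * Complex.I))
      (Complex.exp ((θ : ℂ) * Complex.I) * (1 * Complex.I)) θ :=
    ((hasDerivAt_id (θ : ℂ)).mul_const Complex.I).cexp
  have h3 := (p.hasDerivAt (Complex.exp ((θ : ℂ) * Complex.I))).comp (θ : ℂ) h2
  have h4 := (h1.mul h3).comp_ofReal
  refine h4.congr_deriv ?_
  simp only [circleLiftDeriv, Function.comp]
  ring

/-- The real part of `circleLift`. -/
noncomputable def realLift (n : ℕ) (p : ℂ[X]) (θ : ℝ) : ℝ := (circleLift n p θ).re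

theorem hasDerivAt_realLift (n : ℕ) (p : ℂ[X]) (θ : ℝ) :
    HasDerivAt (realLift n p) (circleLiftDeriv n p θ).re θ :=
  Complex.reCLM.hasFDerivAt.comp_hasDerivAt θ (hasDerivAt_circleLift n p θ)

theorem IsSymmetricPoly.circleLift_eq {p : ℂ[X]} (hp : IsSymmetricPoly p) (θ : ℝ) :
    circleLift p.natDegree p θ = realLift p.natDegree p θ := by
  rw [realLift, eq_comm, ← Complex.conj_eq_iff_re, circleLift, map_mul, ← Complex.exp_conj]
  have hx := hp.eval_eq_of_norm_eq_one (Complex.norm_exp_ofReal_mul_I θ)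
  conv_rhs => rw [hx]
  rw [← Complex.exp_nat_mul, ← mul_assoc, ← Complex.exp_add]
  congr 2
  simp only [map_neg, map_mul, map_div₀, Complex.conj_I, Complex.conj_ofReal, map_natCast,
    map_ofNat]
  ring

theorem IsSymmetricPoly.circleLiftDeriv_eq {p : ℂ[X]} (hp : IsSymmetricPoly p) (θ : ℝ) :
    circleLiftDeriv p.natDegree p θ = (circleLiftDeriv p.natDegree p θ).re := by
  have h1 := (hasDerivAt_realLift p.natDegree p θ).ofReal_comp
  have h2 : (fun θ => (realLift p.natDegree p θ : ℂ)) = circleLift p.natDegree p :=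
    funext fun θ => (hp.circleLift_eq θ).symm
  rw [h2] at h1
  exact (hasDerivAt_circleLift _ p θ).unique h1

theorem IsSymmetricPoly.realLift_eq_zero_iff {p : ℂ[X]} (hp : IsSymmetricPoly p) (θ : ℝ) :
    realLift p.natDegree p θ = 0 ↔ p.IsRoot (Complex.exp (θ * Complex.I)) := by
  rw [← Complex.ofReal_eq_zero, ← hp.circleLift_eq, circleLift]
  simp [Complex.exp_ne_zero]

theorem exists_exp_eq {x : ℂ} (hx : ‖x‖ = 1) : ∃ θ : ℝ, Complex.exp (θ * Complex.I) = x :=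
  (Complex.norm_eq_one_iff x).mp hx

/-- If the Wronskian of `f` and `k` has no zeros, `k` vanishes between any two zeros of `f`. -/
theorem exists_zero_between {f f' k k' : ℝ → ℝ} (hf : ∀ θ, HasDerivAt f (f' θ) θ)
    (hk : ∀ θ, HasDerivAt k (k' θ) θ) (hW : ∀ θ, f' θ * k θ - f θ * k' θ ≠ 0) {a b : ℝ}
    (hab : a < b) (ha : f a = 0) (hb : f b = 0) : ∃ c, a < c ∧ c < b ∧ k c = 0 := by
  by_contra! H
  have hk0 : ∀ θ ∈ Set.Icc a b, k θ ≠ 0 := by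
    intro θ hθ h0
    rcases hθ.1.eq_or_lt with rfl | h1
    · exact hW a (by simp [h0, ha])
    · rcases hθ.2.eq_or_lt with rfl | h2
      · exact hW θ (by simp [h0, hb])
      · exact H θ h1 h2 h0
  -- Otherwise `f / k` is differentiable on the interval and vanishes at both ends, so Rolle gives a
  -- zero of the Wronskian.
  have hd : ∀ θ ∈ Set.Icc a b, HasDerivAt (fun t => f t / k t)
      ((f' θ * k θ - f θ * k' θ) / k θ ^ 2) θ := fun θ hθ => (hf θ).fun_div (hk θ) (hk0 θ hθ)
  obtain ⟨c, hc, hc0⟩ := exists_hasDerivAt_eq_zero (f := fun t => f t / k t) hab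
    (fun θ hθ => (hd θ hθ).continuousAt.continuousWithinAt) (by simp [ha, hb])
    (fun θ hθ => hd θ (Set.Ioo_subset_Icc_self hθ))
  have hkc := hk0 c (Set.Ioo_subset_Icc_self hc)
  rw [div_eq_zero_iff] at hc0
  exact hc0.elim (hW c) (pow_ne_zero 2 hkc)

/-- Uniqueness is existence with the roles exchanged: two zeros of `k` in the gap would enclose a
zero of `f`. -/
theorem oneRootBetween_of_wronskian {p q : ℂ[X]} {f f' k k' : ℝ → ℝ}
    (hf : ∀ θ, HasDerivAt f (f' θ) θ) (hk : ∀ θ, HasDerivAt k (k' θ) θ)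
    (hW : ∀ θ, f' θ * k θ - f θ * k' θ ≠ 0)
    (hfp : ∀ θ : ℝ, f θ = 0 ↔ p.IsRoot (Complex.exp (θ * Complex.I)))
    (hkq : ∀ θ : ℝ, k θ = 0 ↔ q.IsRoot (Complex.exp (θ * Complex.I))) : OneRootBetween p q := by
  rintro φ ψ ⟨hlt, h1, h2, h3⟩
  obtain ⟨c, hc1, hc2, hc3⟩ := exists_zero_between hf hk hW hlt ((hfp _).mpr h1) ((hfp _).mpr h2)
  have hW' : ∀ θ, k' θ * f θ - k θ * f' θ ≠ 0 := fun θ h0 => hW θ (by linear_combination -h0)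
  have key : ∀ s t : ℝ, φ < s → t < ψ → k s = 0 → k t = 0 → ¬ s < t := by
    intro s t hs ht hs0 ht0 hst
    obtain ⟨d, hd1, hd2, hd3⟩ := exists_zero_between hk hf hW' hst hs0 ht0
    exact h3 d (hs.trans hd1) (hd2.trans ht) ((hfp d).mp hd3)
  refine ⟨c, ⟨hc1, hc2, (hkq c).mp hc3⟩, ?_⟩
  rintro d ⟨hd1, hd2, hd3⟩
  rw [← hkq] at hd3
  exact le_antisymm (not_lt.mp (key c d hc1 hd2 hc3 hd3)) (not_lt.mp (key d c hd1 hc2 hd3 hc3))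

theorem simpleRootsOnCircle_of_realLiftDeriv {p : ℂ[X]} (hp : IsSymmetricPoly p)
    (hD : ∀ x : ℂ, ‖x‖ < 1 → p.eval x ≠ 0)
    (hd : ∀ θ, realLift p.natDegree p θ = 0 → (circleLiftDeriv p.natDegree p θ).re ≠ 0) :
    SimpleRootsOnCircle p := by
  intro x hx
  have hx1 := hp.norm_eq_one_of_isRoot hD hx
  refine ⟨hx1, ?_⟩
  have hpos := (rootMultiplicity_pos hp.1).mpr hx
  by_contra hn1
  have h2 := ((one_lt_rootMultiplicity_iff_isRoot (t := x) hp.1).mp (by omega)).2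
  obtain ⟨θ, rfl⟩ := exists_exp_eq hx1
  refine hd θ ((hp.realLift_eq_zero_iff θ).mpr hx) ?_
  rw [IsRoot.def] at hx h2
  simp [circleLiftDeriv, hx, h2]

/-- Equivalent to `2 Re (x conj (x - a)) - |x - a|² = 1 - |a|² > 0`. -/
theorem half_lt_re_div_sub {x a : ℂ} (hx : ‖x‖ = 1) (ha : ‖a‖ < 1) : 1 / 2 < (x * (1 / (x - a))).re := by
  have hxa : x - a ≠ 0 := by
    intro h0
    rw [sub_eq_zero.mp h0] at hx
    exact ha.ne hx
  have hpos := Complex.normSq_pos.mpr hxa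
  have hx2 : x.re * x.re + x.im * x.im = 1 := by
    rw [← Complex.normSq_apply, Complex.normSq_eq_norm_sq, hx, one_pow]
  have ha2 : a.re * a.re + a.im * a.im < 1 := by
    rw [← Complex.normSq_apply, Complex.normSq_eq_norm_sq]
    exact pow_lt_one₀ (norm_nonneg a) ha two_ne_zero
  rw [mul_one_div, Complex.div_re, ← add_div, div_lt_div_iff₀ two_pos hpos, Complex.normSq_apply]
  simp only [Complex.sub_re, Complex.sub_im]
  nlinarith

/-- On the circle, `Re (x p' / p) > n / 2` if all `n` zeros of `p` are in the open disk. -/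
theorem half_natDegree_lt_re {p : ℂ[X]} (hn : 0 < p.natDegree)
    (hz : ∀ x : ℂ, p.eval x = 0 → ‖x‖ < 1) {x : ℂ} (hx : ‖x‖ = 1) :
    (p.natDegree : ℝ) / 2 < (x * ((derivative p).eval x / p.eval x)).re := by
  have hs := IsAlgClosed.splits p
  have hpx : p.eval x ≠ 0 := fun h0 => (hz x h0).ne hx
  have hcard := hs.natDegree_eq_card_roots
  rw [hs.eval_derivative_div_eval_of_ne_zero hpx, ← Multiset.sum_map_mul_left,
    ← Complex.reCLM_apply, map_multiset_sum, Multiset.map_map]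
  have hne : p.roots ≠ ∅ := by
    intro h0
    rw [hcard, h0] at hn
    simp at hn
  have h1 := Multiset.sum_lt_sum_of_nonempty (f := fun _ => (1 / 2 : ℝ))
    (g := fun a => (x * (1 / (x - a))).re) hne
    (fun a ha => half_lt_re_div_sub hx (hz a (isRoot_of_mem_roots ha)))
  rw [Multiset.map_const', Multiset.sum_replicate, nsmul_eq_mul, ← hcard, mul_one_div] at h1
  exact h1

/-- For the lift `L = H - i G` of `P = h - i g`, the Wronskian is `Im (conj L * L')`. Since `L' / L
= i (x P' / P - n / 2)`, it equals `|L|² (Re (x P' / P) - n / 2)`. -/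
theorem wronskian_realLift_pos {g h : ℂ[X]} (hg : IsSymmetricPoly g) (hh : IsSymmetricPoly h)
    (hn : 0 < g.natDegree) (hdeg : h.natDegree = g.natDegree)
    (hP : AllZerosInDisk g.natDegree (h - C Complex.I * g)) (θ : ℝ) :
    0 < (circleLiftDeriv h.natDegree h θ).re * realLift g.natDegree g θ
      - realLift h.natDegree h θ * (circleLiftDeriv g.natDegree g θ).re := by
  have hh1 := hh.circleLift_eq θ
  have hh2 := hh.circleLiftDeriv_eq θ
  have hg1 := hg.circleLift_eq θ
  have hg2 := hg.circleLiftDeriv_eq θ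
  rw [hdeg] at hh1 hh2 ⊢
  obtain ⟨hP0, hPn, hPz⟩ := hP
  set n := g.natDegree
  set P := h - C Complex.I * g with hPdef
  have hx1 : ‖Complex.exp (θ * Complex.I)‖ = 1 := Complex.norm_exp_ofReal_mul_I θ
  have hPx : P.eval (Complex.exp (θ * Complex.I)) ≠ 0 := fun h0 => by
    have := hPz _ h0
    rw [mem_ball_zero_iff] at this
    exact this.ne hx1
  have hre := half_natDegree_lt_re (p := P) (by omega)
    (fun x hx => by simpa using hPz x hx) hx1
  rw [hPn] at hre
  set q := Complex.exp (θ * Complex.I) * ((derivative P).eval (Complex.exp (θ * Complex.I))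
    / P.eval (Complex.exp (θ * Complex.I))) with hq
  have hL : circleLift n P θ = realLift n h θ - Complex.I * realLift n g θ := by
    rw [← hh1, ← hg1, hPdef]
    simp only [circleLift, eval_sub, eval_mul, eval_C]
    ring
  have hD : circleLiftDeriv n P θ = (circleLiftDeriv n h θ).re
      - Complex.I * (circleLiftDeriv n g θ).re := by
    rw [← hh2, ← hg2, hPdef]
    simp only [circleLiftDeriv, derivative_sub, derivative_C_mul, eval_sub, eval_mul, eval_C]
    ring
  have hDL : circleLiftDeriv n P θ = Complex.I * (q - n / 2) * circleLift n P θ := by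
    have hqP : q * P.eval (Complex.exp (θ * Complex.I)) = Complex.exp (θ * Complex.I) *
        (derivative P).eval (Complex.exp (θ * Complex.I)) := by
      rw [hq, mul_assoc, div_mul_cancel₀ _ hPx]
    rw [circleLiftDeriv, circleLift, ← hqP]
    ring
  have hL0 : circleLift n P θ ≠ 0 := mul_ne_zero (Complex.exp_ne_zero _) hPx
  have him : (conj (circleLift n P θ) * circleLiftDeriv n P θ).im
      = Complex.normSq (circleLift n P θ) * (q.re - n / 2) := by
    rw [hDL, show conj (circleLift n P θ) * (Complex.I * (q - n / 2) * circleLift n P θ)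
      = (circleLift n P θ * conj (circleLift n P θ)) * (Complex.I * (q - n / 2)) by ring,
      Complex.mul_conj, Complex.im_ofReal_mul]
    congr 1
    simp
  have hpos : 0 < Complex.normSq (circleLift n P θ) * (q.re - n / 2) :=
    mul_pos (Complex.normSq_pos.mpr hL0) (by linarith)
  rw [← him, hL, hD] at hpos
  simp at hpos
  linarith

theorem interlacingRoots_of_coversHalfPlane {g h : ℂ[X]} (hg : IsSymmetricPoly g)
    (hh : IsSymmetricPoly h) (hn : 0 < g.natDegree) (H : CoversHalfPlane g h {z | 0 < z.im}) :
    InterlacingRoots g h := by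
  have hdeg := H.natDegree_eq hg hh
  have hS := splitsHalfPlanes_of_coversHalfPlane hdeg.le H
  have hW := wronskian_realLift_pos hg hh hn hdeg (hS.2 Complex.I (by simp))
  have hhD : ∀ x : ℂ, ‖x‖ < 1 → h.eval x ≠ 0 := by
    intro x hx h0
    have := H.2.1 x hx
    simp [h0] at this
  refine ⟨?_, ?_, ?_, ?_⟩
  · refine simpleRootsOnCircle_of_realLiftDeriv hg H.1 fun θ h0 h1 => ?_
    have := hW θ
    simp [h0, h1] at this
  · refine simpleRootsOnCircle_of_realLiftDeriv hh hhD fun θ h0 h1 => ?_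
    have := hW θ
    simp [h0, h1] at this
  · refine oneRootBetween_of_wronskian (hasDerivAt_realLift _ g) (hasDerivAt_realLift _ h)
      (fun θ h0 => (hW θ).ne ?_) hg.realLift_eq_zero_iff hh.realLift_eq_zero_iff
    linear_combination h0
  · exact oneRootBetween_of_wronskian (hasDerivAt_realLift _ h) (hasDerivAt_realLift _ g)
      (fun θ => (hW θ).ne') hh.realLift_eq_zero_iff hg.realLift_eq_zero_iff

/-! ### Counting roots along the circle -/

theorem exists_int_of_exp_eq {s t : ℝ}
    (h : Complex.exp (s * Complex.I) = Complex.exp (t * Complex.I)) :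
    ∃ k : ℤ, s = t + k * (2 * Real.pi) := by
  obtain ⟨k, hk⟩ := Complex.exp_eq_exp_iff_exists_int.mp h
  refine ⟨k, ?_⟩
  have h1 := congrArg Complex.im hk
  simpa using h1

theorem exp_add_int_mul_two_pi (t : ℝ) (k : ℤ) :
    Complex.exp (((t + k * (2 * Real.pi) : ℝ) : ℂ) * Complex.I) = Complex.exp (t * Complex.I) := by
  rw [Complex.exp_eq_exp_iff_exists_int]
  exact ⟨k, by push_cast; ring⟩

theorem exists_consecutiveRootArgs {p : ℂ[X]} (hp : p ≠ 0) {φ : ℝ}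
    (hφ : p.IsRoot (Complex.exp (φ * Complex.I))) : ∃ ψ, ConsecutiveRootArgs p φ ψ := by
  set S : Set ℝ := {θ | θ ∈ Set.Ioc φ (φ + 2 * Real.pi) ∧
    p.IsRoot (Complex.exp (θ * Complex.I))} with hS
  have hfin : S.Finite := by
    refine Set.Finite.of_injOn (f := fun θ : ℝ => Complex.exp (θ * Complex.I))
      (t := {x | p.IsRoot x}) (fun θ hθ => hθ.2) ?_ (p.finite_setOfPred_isRoot hp)
    intro s hs t ht hst
    obtain ⟨k, hk⟩ := exists_int_of_exp_eq hst
    have h1 := hs.1.1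
    have h2 := hs.1.2
    have h3 := ht.1.1
    have h4 := ht.1.2
    have hpi := Real.two_pi_pos
    have hk1 : (k : ℝ) < 1 := by nlinarith
    have hk2 : (-1 : ℝ) < k := by nlinarith
    have hk1' : k < 1 := by exact_mod_cast hk1
    have hk2' : -1 < k := by exact_mod_cast hk2
    have hk0 : k = 0 := by omega
    simpa [hk0] using hk
  have hne : S.Nonempty := by
    -- The interval is closed on the right so that a single root is followed by itself after a full
    -- turn.
    refine ⟨φ + 2 * Real.pi, ⟨by linarith [Real.two_pi_pos], le_rfl⟩, ?_⟩
    have := exp_add_int_mul_two_pi φ 1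
    rw [Int.cast_one, one_mul] at this
    rwa [this]
  obtain ⟨ψ, hψ, hmin⟩ := hfin.exists_minimal hne
  refine ⟨ψ, hψ.1.1, hφ, hψ.2, fun θ h1 h2 h3 => ?_⟩
  exact absurd (hmin ⟨⟨h1, h2.le.trans hψ.1.2⟩, h3⟩ h2.le) (not_le.mpr h2)

/-- If every arc between consecutive roots of `p` contains a root of `q`, then `q` has at least as
many roots on the circle as `p`. -/
theorem card_roots_le_of_root_between {p q : ℂ[X]} (hp : p ≠ 0) (hq : q ≠ 0)
    (hcirc : ∀ x : ℂ, p.IsRoot x → ‖x‖ = 1)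
    (hgap : ∀ φ ψ : ℝ, ConsecutiveRootArgs p φ ψ →
      ∃ θ : ℝ, φ < θ ∧ θ < ψ ∧ q.IsRoot (Complex.exp (θ * Complex.I))) :
    p.roots.toFinset.card ≤ (q.roots.toFinset.filter (fun x => ‖x‖ = 1)).card := by
  have hdata : ∀ x ∈ p.roots.toFinset, ∃ d : ℝ × ℝ × ℝ, Complex.exp (d.1 * Complex.I) = x ∧
      ConsecutiveRootArgs p d.1 d.2.1 ∧ d.1 < d.2.2 ∧ d.2.2 < d.2.1 ∧
        q.IsRoot (Complex.exp (d.2.2 * Complex.I)) := by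
    intro x hx
    rw [Multiset.mem_toFinset, mem_roots hp] at hx
    obtain ⟨φ, rfl⟩ := exists_exp_eq (hcirc x hx)
    obtain ⟨ψ, hψ⟩ := exists_consecutiveRootArgs hp hx
    obtain ⟨θ, h1, h2, h3⟩ := hgap φ ψ hψ
    exact ⟨(φ, ψ, θ), rfl, hψ, h1, h2, h3⟩
  choose! d hd1 hd2 hd3 hd4 hd5 using hdata
  -- If two chosen roots of `q` agree up to full turns, their gaps overlap. No gap contains a root
  -- of `p`, so neither starts inside the other, and the two starting points agree.
  have key : ∀ x ∈ p.roots.toFinset, ∀ y ∈ p.roots.toFinset, ∀ k : ℤ,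
      (d x).2.2 = (d y).2.2 + k * (2 * Real.pi) → (d y).1 + k * (2 * Real.pi) ≤ (d x).1 := by
    intro x hx y hy k hk
    by_contra! hlt
    refine (hd2 x hx).2.2.2 _ hlt ?_ ?_
    · linarith [hd3 y hy, hd4 x hx]
    · rw [exp_add_int_mul_two_pi]
      exact (hd2 y hy).2.1
  refine Finset.card_le_card_of_injOn (fun x => Complex.exp ((d x).2.2 * Complex.I)) ?_ ?_
  · intro x hx
    rw [Finset.mem_coe, Finset.mem_filter, Multiset.mem_toFinset, mem_roots hq]
    exact ⟨hd5 x hx, Complex.norm_exp_ofReal_mul_I _⟩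
  · intro x hx y hy hxy
    obtain ⟨k, hk⟩ := exists_int_of_exp_eq hxy
    have h1 := key x hx y hy k hk
    have h2 := key y hy x hx (-k) (by push_cast; linarith)
    push_cast at h2
    have h3 : (d x).1 = (d y).1 + k * (2 * Real.pi) := by linarith
    rw [← hd1 x hx, ← hd1 y hy, h3, exp_add_int_mul_two_pi]

theorem SimpleRootsOnCircle.card_roots {p : ℂ[X]} (hp : SimpleRootsOnCircle p) (hp0 : p ≠ 0) :
    p.roots.toFinset.card = p.natDegree := by
  rw [(IsAlgClosed.splits p).natDegree_eq_card_roots, ← Multiset.toFinset_sum_count_eq,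
    Finset.card_eq_sum_ones]
  refine Finset.sum_congr rfl fun x hx => ?_
  rw [Multiset.mem_toFinset, mem_roots hp0] at hx
  rw [count_roots, (hp x hx).2]

theorem natDegree_le_of_oneRootBetween {p q : ℂ[X]} (hp0 : p ≠ 0) (hq0 : q ≠ 0)
    (hp : SimpleRootsOnCircle p) (hpq : OneRootBetween p q) : p.natDegree ≤ q.natDegree := by
  rw [← hp.card_roots hp0]
  refine (card_roots_le_of_root_between hp0 hq0 (fun x hx => (hp x hx).1)
    (fun φ ψ h => (hpq φ ψ h).exists)).trans ?_
  refine (Finset.card_le_card (Finset.filter_subset _ _)).trans ?_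
  exact (Multiset.toFinset_card_le _).trans (card_roots' q)

/-- From a common root, the next root of `h` would come before the next root of `g`, and then a root
of `g` would come before that. -/
theorem InterlacingRoots.not_isRoot {g h : ℂ[X]} (H : InterlacingRoots g h) (hg : g ≠ 0)
    (hh : h ≠ 0) {x : ℂ} (hx : g.IsRoot x) : ¬ h.IsRoot x := by
  obtain ⟨hgs, _, hgh, hhg⟩ := H
  intro hx'
  obtain ⟨φ, rfl⟩ := exists_exp_eq (hgs x hx).1
  obtain ⟨ψ, hψ⟩ := exists_consecutiveRootArgs hg hx
  obtain ⟨ψ', hψ'⟩ := exists_consecutiveRootArgs hh hx'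
  obtain ⟨θ, h1, h2, h3⟩ := (hgh φ ψ hψ).exists
  obtain ⟨θ', h1', h2', h3'⟩ := (hhg φ ψ' hψ').exists
  have hle : ψ' ≤ θ := not_lt.mp fun hlt => hψ'.2.2.2 θ h1 hlt h3
  exact hψ.2.2.2 θ' h1' (h2'.trans (hle.trans_lt h2)) h3'

theorem exists_zero_of_mul_neg {f : ℝ → ℝ} (hf : Continuous f) {a b : ℝ} (hab : a < b)
    (h : f a * f b < 0) : ∃ c, a < c ∧ c < b ∧ f c = 0 := by
  rcases mul_neg_iff.mp h with ⟨h1, h2⟩ | ⟨h1, h2⟩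
  · obtain ⟨c, hc, hc0⟩ := intermediate_value_Ioo' hab.le hf.continuousOn ⟨h2, h1⟩
    exact ⟨c, hc.1, hc.2, hc0⟩
  · obtain ⟨c, hc, hc0⟩ := intermediate_value_Ioo hab.le hf.continuousOn ⟨h1, h2⟩
    exact ⟨c, hc.1, hc.2, hc0⟩

/-- A function changes sign across a unique simple zero. -/
theorem mul_neg_of_unique_simple_zero {f : ℝ → ℝ} (hf : Continuous f) {a b c f' : ℝ}
    (hac : a < c) (hcb : c < b) (ha : f a ≠ 0) (hb : f b ≠ 0) (hc : f c = 0)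
    (hd : HasDerivAt f f' c) (hf' : f' ≠ 0)
    (huniq : ∀ t, a < t → t < b → f t = 0 → t = c) : f a * f b < 0 := by
  by_contra hcon
  have hab : 0 < f a * f b := lt_of_le_of_ne (not_lt.mp hcon) (mul_ne_zero ha hb).symm
  -- Without a sign change, `c` would be a local minimum of `f a * f`, against the nonzero
  -- derivative.
  have hleft : ∀ t, a < t → t < b → 0 ≤ f a * f t := by
    intro t h1 h2
    by_contra! hneg
    rcases lt_trichotomy t c with htc | htc | htc
    · obtain ⟨s, hs1, hs2, hs3⟩ := exists_zero_of_mul_neg hf h1 hneg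
      exact (hs2.trans htc).ne (huniq s hs1 (hs2.trans h2) hs3)
    · simp [htc, hc] at hneg
    · have hneg' : f t * f b < 0 := by
        have h3 : (f a * f t) * (f a * f b) < 0 := mul_neg_of_neg_of_pos hneg hab
        have h4 : 0 < f a * f a := mul_self_pos.mpr ha
        by_contra! h5
        nlinarith [mul_nonneg h4.le h5]
      obtain ⟨s, hs1, hs2, hs3⟩ := exists_zero_of_mul_neg hf h2 hneg'
      exact (htc.trans hs1).ne' (huniq s (h1.trans hs1) hs2 hs3)
  have hmin : IsLocalMin (fun t => f a * f t) c := by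
    filter_upwards [Ioo_mem_nhds hac hcb] with t ht
    rw [hc, mul_zero]
    exact hleft t ht.1 ht.2
  exact mul_ne_zero ha hf' (hmin.hasDerivAt_eq_zero (hd.const_mul (f a)))

/-! ### From interlacing to a covering -/

theorem continuous_realLift (n : ℕ) (p : ℂ[X]) : Continuous (realLift n p) :=
  continuous_iff_continuousAt.mpr fun θ => (hasDerivAt_realLift n p θ).continuousAt

/-- For real `t`, the polynomial `h - t g` has a root between any two consecutive roots of `g`. -/
theorem InterlacingRoots.exists_root_between {g h : ℂ[X]} (H : InterlacingRoots g h)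
    (hg : IsSymmetricPoly g) (hh : IsSymmetricPoly h) (hdeg : h.natDegree = g.natDegree) (t : ℝ)
    {φ ψ : ℝ} (hc : ConsecutiveRootArgs g φ ψ) :
    ∃ θ : ℝ, φ < θ ∧ θ < ψ ∧ (h - C (t : ℂ) * g).IsRoot (Complex.exp (θ * Complex.I)) := by
  obtain ⟨θ, ⟨h1, h2, h3⟩, huniq⟩ := H.2.2.1 φ ψ hc
  have hφ : realLift h.natDegree h φ ≠ 0 := fun h0 =>
    H.not_isRoot hg.1 hh.1 hc.2.1 ((hh.realLift_eq_zero_iff φ).mp h0)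
  have hψ : realLift h.natDegree h ψ ≠ 0 := fun h0 =>
    H.not_isRoot hg.1 hh.1 hc.2.2.1 ((hh.realLift_eq_zero_iff ψ).mp h0)
  have hd : (circleLiftDeriv h.natDegree h θ).re ≠ 0 := by
    intro h0
    have h4 := hh.circleLiftDeriv_eq θ
    rw [h0, circleLiftDeriv, h3.eq_zero] at h4
    have h5 : (derivative h).IsRoot (Complex.exp (θ * Complex.I)) := by
      simpa [Complex.exp_ne_zero] using h4
    have h6 := (one_lt_rootMultiplicity_iff_isRoot hh.1).mpr ⟨h3, h5⟩
    rw [(H.2.1 _ h3).2] at h6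
    exact lt_irrefl 1 h6
  have hneg := mul_neg_of_unique_simple_zero (continuous_realLift _ h) h1 h2 hφ hψ
    ((hh.realLift_eq_zero_iff θ).mpr h3) (hasDerivAt_realLift _ h θ) hd
    (fun s hs1 hs2 hs3 => huniq s ⟨hs1, hs2, (hh.realLift_eq_zero_iff s).mp hs3⟩)
  have hgφ := (hg.realLift_eq_zero_iff φ).mpr hc.2.1
  have hgψ := (hg.realLift_eq_zero_iff ψ).mpr hc.2.2.1
  -- At the ends of the gap the lift of `g` vanishes, so the lift of `h - t g` has there the
  -- opposite signs of the lift of `h`, whatever `t` is.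
  obtain ⟨s, hs1, hs2, hs3⟩ := exists_zero_of_mul_neg
    (f := fun s => realLift h.natDegree h s - t * realLift g.natDegree g s)
    ((continuous_realLift _ h).sub ((continuous_realLift _ g).const_mul t)) hc.1
    (by simpa [hgφ, hgψ] using hneg)
  refine ⟨s, hs1, hs2, ?_⟩
  have hs4 : (realLift h.natDegree h s : ℂ) - t * realLift g.natDegree g s = 0 := by
    exact_mod_cast hs3
  rw [← hh.circleLift_eq, ← hg.circleLift_eq, hdeg, circleLift, circleLift] at hs4
  refine (mul_eq_zero.mp (?_ : Complex.exp (-(g.natDegree / 2 * s * Complex.I)) * _ = 0)).resolve_left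
    (Complex.exp_ne_zero _)
  simp only [eval_sub, eval_mul, eval_C]
  linear_combination hs4

theorem InterlacingRoots.natDegree_eq {g h : ℂ[X]} (H : InterlacingRoots g h) (hg : g ≠ 0)
    (hh : h ≠ 0) : h.natDegree = g.natDegree :=
  le_antisymm (natDegree_le_of_oneRootBetween hh hg H.2.1 H.2.2.2)
    (natDegree_le_of_oneRootBetween hg hh H.1 H.2.2.1)

theorem SimpleRootsOnCircle.eval_ne_zero {p : ℂ[X]} (hp : SimpleRootsOnCircle p) {x : ℂ}
    (hx : ‖x‖ < 1) : p.eval x ≠ 0 := fun h0 => hx.ne (hp x h0).1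

/-- A real value `t` at `x` would add a zero in the disk to the `n` zeros of `h - t g` on the
circle, exceeding its degree. -/
theorem InterlacingRoots.im_ne_zero {g h : ℂ[X]} (H : InterlacingRoots g h)
    (hg : IsSymmetricPoly g) (hh : IsSymmetricPoly h) (hn : 0 < g.natDegree) {x : ℂ}
    (hx : ‖x‖ < 1) : (h.eval x / g.eval x).im ≠ 0 := by
  intro him
  have hdeg := H.natDegree_eq hg.1 hh.1
  set t := (h.eval x / g.eval x).re
  have ht : h.eval x / g.eval x = t := Complex.ext (by simp [t]) (by simp [him])
  have hroot := (eval_div_eq_iff (H.1.eval_ne_zero hx)).mp ht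
  have hne : h - C (t : ℂ) * g ≠ 0 := by
    intro h0
    obtain ⟨y, hy⟩ := IsAlgClosed.exists_root g (by
      rw [degree_eq_natDegree hg.1]; exact_mod_cast hn.ne')
    refine H.not_isRoot hg.1 hh.1 hy ?_
    rw [sub_eq_zero.mp h0, IsRoot.def, eval_mul, hy.eq_zero, mul_zero]
  have hcard := card_roots_le_of_root_between hg.1 hne (fun y hy => (H.1 y hy).1)
    (fun φ ψ hc => H.exists_root_between hg hh hdeg t hc)
  rw [H.1.card_roots hg.1] at hcard
  set T := (h - C (t : ℂ) * g).roots.toFinset.filter (fun x => ‖x‖ = 1) with hT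
  have hxT : x ∉ T := fun h0 => hx.ne (Finset.mem_filter.mp h0).2
  have hsub : insert x T ⊆ (h - C (t : ℂ) * g).roots.toFinset := by
    refine Finset.insert_subset ?_ (Finset.filter_subset _ _)
    rw [Multiset.mem_toFinset, mem_roots hne]
    exact hroot
  have h1 := Finset.card_le_card hsub
  rw [Finset.card_insert_of_notMem hxT] at h1
  have h2 := (Multiset.toFinset_card_le _).trans (card_roots' (h - C (t : ℂ) * g))
  have h3 : (h - C (t : ℂ) * g).natDegree ≤ g.natDegree :=
    (natDegree_sub_le _ _).trans (max_le hdeg.le (natDegree_C_mul_le _ _))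
  omega

theorem InterlacingRoots.im_pos {g h : ℂ[X]} (H : InterlacingRoots g h)
    (hg : IsSymmetricPoly g) (hh : IsSymmetricPoly h) (hn : 0 < g.natDegree)
    (h0 : 0 < (h.eval 0 / g.eval 0).im) {x : ℂ} (hx : ‖x‖ < 1) :
    0 < (h.eval x / g.eval x).im := by
  by_contra! hle
  have hcont : ContinuousOn (fun y => (h.eval y / g.eval y).im) (Metric.ball 0 1) := by
    intro y hy
    have hgy := H.1.eval_ne_zero (x := y) (by simpa using hy)
    exact (Complex.continuous_im.continuousAt.comp
      (analyticAt_eval_div g h hgy).continuousAt).continuousWithinAt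
  obtain ⟨y, hy, hy0⟩ := (convex_ball (0 : ℂ) 1).isPreconnected.intermediate_value₂
    (a := x) (b := 0) (by simpa using hx) (by simp) hcont continuousOn_const hle h0.le
  exact H.im_ne_zero hg hh hn (by simpa using hy) hy0

theorem IsSymmetricPoly.coeff_natDegree_eq {p : ℂ[X]} (hp : IsSymmetricPoly p) :
    p.coeff p.natDegree = conj (p.eval 0) := by
  rw [← coeff_zero_eq_eval_zero]
  conv_rhs => rw [← hp.2]
  rw [coeff_map, coeff_zero_reverse, Complex.conj_conj, coeff_natDegree]

theorem InterlacingRoots.coversHalfPlane {g h : ℂ[X]} (H : InterlacingRoots g h)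
    (hg : IsSymmetricPoly g) (hh : IsSymmetricPoly h) (hn : 0 < g.natDegree)
    (h0 : 0 < (h.eval 0 / g.eval 0).im) : CoversHalfPlane g h {z | 0 < z.im} := by
  have hdeg := H.natDegree_eq hg.1 hh.1
  have hlow : ∀ z : ℂ, z.im < 0 → ∀ x : ℂ, ‖x‖ < 1 → (h - C z * g).eval x ≠ 0 := by
    intro z hz x hx hx0
    have h1 := H.im_pos hg hh hn h0 hx
    rw [(eval_div_eq_iff (H.1.eval_ne_zero hx)).mpr hx0] at h1
    exact lt_asymm hz h1
  refine coversHalfPlane_of_splitsHalfPlanes hg.1 hn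
    ⟨fun z hz x hx => hlow z hz x (by simpa using hx), fun z hz => ?_⟩
  have hzc : (conj z).im < 0 := by simpa using hz
  -- By symmetry this coefficient is the conjugate of `h - conj z * g` at the origin, which is
  -- nonzero because `conj z` lies in the lower half-plane.
  have hcoeff : (h - C z * g).coeff g.natDegree ≠ 0 := by
    have h1 := hlow _ hzc 0 (by simp)
    have h2 := hh.coeff_natDegree_eq
    rw [hdeg] at h2
    rw [coeff_sub, coeff_C_mul, h2, hg.coeff_natDegree_eq]
    intro h3
    refine h1 ?_
    have h4 := congrArg conj h3
    simpa using h4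
  refine ⟨fun h1 => hcoeff (by simp [h1]), ?_, fun y hy => ?_⟩
  · refine le_antisymm ?_ (le_natDegree_of_ne_zero hcoeff)
    exact (natDegree_sub_le _ _).trans (max_le hdeg.le (natDegree_C_mul_le _ _))
  · rw [mem_ball_zero_iff]
    by_contra! hy1
    have hy0 : y ≠ 0 := by rintro rfl; simp at hy1; linarith
    simp only [eval_sub, eval_mul, eval_C] at hy
    rcases hy1.eq_or_lt with hy1 | hy1
    · have hgy : g.eval y ≠ 0 := by
        intro hgy
        refine H.not_isRoot hg.1 hh.1 hgy ?_
        rw [IsRoot.def]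
        simpa [hgy] using hy
      have e1 := hh.eval_eq_of_norm_eq_one hy1.symm
      have e2 := hg.eval_eq_of_norm_eq_one hy1.symm
      have e3 := congrArg conj hy
      simp only [map_sub, map_mul, map_zero] at e3
      rw [hdeg] at e1
      have e4 : (conj z - z) * g.eval y = 0 := by
        linear_combination hy - e1 + (conj z) * e2 - (y ^ g.natDegree) * e3
      have e5 := (mul_eq_zero.mp e4).resolve_right hgy
      have e6 := congrArg Complex.im e5
      simp at e6
      linarith
    · have e1 := hh.eval_eq hy0
      have e2 := hg.eval_eq hy0
      rw [hdeg] at e1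
      rw [e1, e2] at hy
      -- A zero of `h - z g` outside the disk reflects to a zero of `h - conj z * g` inside.
      refine hlow _ hzc (conj y)⁻¹ ?_ ?_
      · rw [norm_inv, RCLike.norm_conj]
        exact inv_lt_one_of_one_lt₀ hy1
      · have e3 : y ^ g.natDegree * (conj (h.eval (conj y)⁻¹) - z * conj (g.eval (conj y)⁻¹)) = 0 := by
          linear_combination hy
        have e4 := congrArg conj ((mul_eq_zero.mp e3).resolve_left (pow_ne_zero _ hy0))
        simpa using e4

/-! ### Change of sign and conclusion -/

theorem IsSymmetricPoly.neg {p : ℂ[X]} (hp : IsSymmetricPoly p) : IsSymmetricPoly (-p) :=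
  ⟨neg_ne_zero.mpr hp.1, by rw [reverse_neg, Polynomial.map_neg, hp.2]⟩

theorem interlacingRoots_neg {g h : ℂ[X]} : InterlacingRoots g (-h) ↔ InterlacingRoots g h := by
  have hr : ∀ x : ℂ, (-h).IsRoot x ↔ h.IsRoot x := fun x => by simp [IsRoot.def]
  have hm : ∀ x : ℂ, (-h).rootMultiplicity x = h.rootMultiplicity x := fun x => by
    rw [← count_roots, roots_neg, count_roots]
  simp only [InterlacingRoots, SimpleRootsOnCircle, OneRootBetween, ConsecutiveRootArgs, hr, hm]

theorem splitsHalfPlanes_neg {g h : ℂ[X]} : SplitsHalfPlanes g (-h) ↔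
    (∀ z : ℂ, 0 < z.im → NoZerosInDisk (h - C z * g)) ∧
      ∀ z : ℂ, z.im < 0 → AllZerosInDisk g.natDegree (h - C z * g) := by
  have key : ∀ z : ℂ, -h - C z * g = -(h - C (-z) * g) := fun z => by simp; ring
  have hN : ∀ p : ℂ[X], NoZerosInDisk (-p) ↔ NoZerosInDisk p := fun p => by simp [NoZerosInDisk]
  have hA : ∀ p : ℂ[X], AllZerosInDisk g.natDegree (-p) ↔ AllZerosInDisk g.natDegree p := fun p => by
    simp [AllZerosInDisk]
  simp only [SplitsHalfPlanes, key, hN, hA]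
  refine and_congr ⟨fun H z hz => ?_, fun H z hz => H (-z) (by simpa using hz)⟩
    ⟨fun H z hz => ?_, fun H z hz => H (-z) (by simpa using hz)⟩
  · simpa only [neg_neg] using H (-z) (by simpa using hz)
  · simpa only [neg_neg] using H (-z) (by simpa using hz)

theorem coversHalfPlane_iff_splitsHalfPlanes {g h : ℂ[X]} (hg : IsSymmetricPoly g)
    (hh : IsSymmetricPoly h) (hn : 0 < g.natDegree) :
    CoversHalfPlane g h {z | 0 < z.im} ↔ SplitsHalfPlanes g h :=
  ⟨fun H => splitsHalfPlanes_of_coversHalfPlane (H.natDegree_eq hg hh).le H,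
    coversHalfPlane_of_splitsHalfPlanes hg.1 hn⟩

theorem theorem7 (g h : ℂ[X]) (hg : IsSymmetricPoly g) (hh : IsSymmetricPoly h)
    (hn : 0 < g.natDegree) :
    (InterlacingRoots g h ↔
      QuotientMapsDisk g.natDegree g h {z | 0 < z.im} ∨
        QuotientMapsDisk g.natDegree g h {z | z.im < 0}) ∧
    (QuotientMapsDisk g.natDegree g h {z | 0 < z.im} ↔
      (∀ z : ℂ, z.im < 0 → NoZerosInDisk (h - C z * g)) ∧
        ∀ z : ℂ, 0 < z.im → AllZerosInDisk g.natDegree (h - C z * g)) ∧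
    (QuotientMapsDisk g.natDegree g h {z | z.im < 0} ↔
      (∀ z : ℂ, 0 < z.im → NoZerosInDisk (h - C z * g)) ∧
        ∀ z : ℂ, z.im < 0 → AllZerosInDisk g.natDegree (h - C z * g)) := by
  simp only [quotientMapsDisk_iff]
  refine ⟨⟨fun H => ?_, ?_⟩, coversHalfPlane_iff_splitsHalfPlanes hg hh hn, ?_⟩
  · rcases lt_or_gt_of_ne (H.im_ne_zero hg hh hn (x := 0) (by simp)) with h0 | h0
    · refine Or.inr (coversHalfPlane_neg.mp ?_)
      refine (interlacingRoots_neg.mpr H).coversHalfPlane hg hh.neg hn ?_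
      simpa [neg_div] using h0
    · exact Or.inl (H.coversHalfPlane hg hh hn h0)
  · rintro (H | H)
    · exact interlacingRoots_of_coversHalfPlane hg hh hn H
    · exact interlacingRoots_neg.mp
        (interlacingRoots_of_coversHalfPlane hg hh.neg hn (coversHalfPlane_neg.mpr H))
  · rw [← coversHalfPlane_neg, coversHalfPlane_iff_splitsHalfPlanes hg hh.neg hn,
      splitsHalfPlanes_neg]
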